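/- Let $K$ be a field, let $G$ be a simple graph on $[n]=\{1,\dots,n\}$, and let $G_1,\dots,G_s$ be its connected components. For an induced subgraph $H$ of $G$ with vertex set $V_H\subseteq[n]$ (with the induced order), let $$J_H=(x_iy_j-x_jy_i \mid \{i,j\}\in E(H))\subseteq S_H=K[x_i,y_i\mid i\in V_H]$$ be its binomial edge ideal, let $\operatorname{in}(J_H)$ be its initial ideal with respect to the lexicographic order in which all $x_i$ are larger than all $y_j$, and $x_i>x_j$, $y_i>y_j$ for $i<j$, and let $\operatorname{gin}(J_H)$ be its multigraded generic initial ideal for the same order and the grading $\deg x_i=\deg y_i=\mathbf e_i$, that is, the monomial ideal of $S_H$ generated by the leading monomials of the nonzero elements of the ideal obtained from $J_H$ by a generic linear change of coordinates $x_i\mapsto t^{(i)}_{11}x_i+t^{(i)}_{12}y_i$, $y_i\mapsto t^{(i)}_{21}x_i+t^{(i)}_{22}y_i$ ($i\in V_H$), where the $t^{(i)}_{ab}$ are independent indeterminates over $K$ and the ideal is extended to $K(t)[x_i,y_i \mid i\in V_H]$. (If $K$ is infinite, this agrees with the leading monomial ideal after a change of coordinates by a general element of $\prod_{i\in V_H}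 GL_2(K)$.) For a radical ideal $I$ with minimal primes $P_1,\dots,P_r$ and $m\ge1$ let $I^{(m)}=\bigcap_k P_k^{(m)}$, where $P^{(m)}=\{r\mid rq\in P^m\text{ for some }q\notin P\}$ for a prime $P$. For a squarefree monomial ideal $I$ of a polynomial ring $K[z_1,\dots,z_N]$ let $$\operatorname{SP}(I)=\operatorname{conv}\left\{\tfrac aq \;\middle|\; q\ge 1,\ a\in\mathbb Z_{\ge0}^N,\ z^a\in I^{(q)}\right\}\subseteq\mathbb R^N$$ be its symbolic polyhedron, and let $\mathcal V(\operatorname{SP}(I))$ be the set of its vertices (extreme points). For each $j$ let $i_j:\mathbb R^{2|V_{G_j}|}\to\mathbb R^{2n}$ be the canonical inclusion, which keeps the two coordinates belonging to each vertex of $G_j$ and puts zeros at the coordinates belonging to all other vertices. Then, both for $I_H=\operatorname{gin}(J_H)$ (all $H$) and for $I_H=\operatorname{in}(J_H)$ (all $H$), $$\mathcal V(\operatorname{SP}(I_G))=\bigsqcup_{j=1}^s i_j\bigl(\mathcal V(\operatorname{SP}(I_{G_j}))\bigr),$$ the sets on the right-hand side being pairwise disjoint (some of them may be empty: $\operatorname{SP}(0)=\varnothing$).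 -/

import Mathlib

open MvPolynomial

noncomputable section

/-- The index set of the variables `x_v, y_v` (`v ∈ V`), linearly ordered with all `x`-indices
before all `y`-indices. -/
abbrev Vars (V : Type*) : Type _ := Lex (V ⊕ V)

/-- The index of the variable `x_v`. -/
def xIdx {V : Type*} (v : V) : Vars V := toLex (Sum.inl v)

/-- The index of the variable `y_v`. -/
def yIdx {V : Type*} (v : V) : Vars V := toLex (Sum.inr v)

instance instFiniteVars {V : Type*} [Finite V] : Finite (Vars V) :=
  inferInstanceAs (Finite (V ⊕ V))

/-- The lexicographic term order with `x_1 > ⋯ > x_n > y_1 > ⋯ > y_n`.  (In Mathlib's lexicographic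
order the variable with the smallest index is the largest one.) -/
def lexOrder (V : Type*) [LinearOrder V] [Finite V] : MonomialOrder (Vars V) :=
  MonomialOrder.lex

/-- The ideal of `K[x_v, y_v]` generated by the leading monomials of the nonzero elements of the
ideal `I` of `L[x_v, y_v]`.  For `L = K` this is the initial ideal of `I`. -/
def leadingMonomialIdeal (K : Type*) {L V : Type*} [Field K] [Field L] [LinearOrder V] [Finite V]
    (I : Ideal (MvPolynomial (Vars V) L)) : Ideal (MvPolynomial (Vars V) K) :=
  Ideal.span {p | ∃ f ∈ I, f ≠ 0 ∧ p = monomial ((lexOrder V).degree f) 1}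

/-- The initial ideal of `I` for the lexicographic order. -/
def initialIdeal {K V : Type*} [Field K] [LinearOrder V] [Finite V]
    (I : Ideal (MvPolynomial (Vars V) K)) : Ideal (MvPolynomial (Vars V) K) :=
  leadingMonomialIdeal K I

/-- The field `K(t)` obtained by adjoining to `K` the entries of generic `2 × 2` matrices
`t^{(v)}`, one for every `v ∈ V`. -/
abbrev GenericField (K V : Type*) [Field K] : Type _ :=
  FractionRing (MvPolynomial (V × Fin 2 × Fin 2) K)

/-- The entry `t^{(v)}_{ab}` of the generic matrix at `v`. -/
def genericEntry (K : Type*) {V : Type*} [Field K] (v : V) (a b : Fin 2) : GenericField K V :=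
  algebraMap (MvPolynomial (V × Fin 2 × Fin 2) K) (GenericField K V) (X (v, a, b))

/-- The generic multigraded linear change of coordinates, for the grading
`deg x_v = deg y_v = e_v`: it sends `x_v` and `y_v` to generic linear forms in `x_v, y_v`. -/
def genericChange (K V : Type*) [Field K] :
    MvPolynomial (Vars V) K →ₐ[K] MvPolynomial (Vars V) (GenericField K V) :=
  aeval fun k => match ofLex k with
    | Sum.inl v => C (genericEntry K v 0 0) * X (xIdx v) + C (genericEntry K v 0 1) * X (yIdx v)
    | Sum.inr v => C (genericEntry K v 1 0) * X (xIdx v) + C (genericEntry K v 1 1) * X (yIdx v)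

/-- The multigraded generic initial ideal of `I` for the lexicographic order: the monomial ideal
generated by the leading monomials of the elements of the extension of `I` to `K(t)[x_v, y_v]`,
after the generic multigraded change of coordinates.  (Over an infinite field this is
the initial ideal of `g(I)` for all `g` in a nonempty Zariski open subset of `∏_v GL₂(K)`; working
at the generic point gives the same ideal and makes sense over every field.) -/
def multigradedGin {K V : Type*} [Field K] [LinearOrder V] [Finite V]
    (I : Ideal (MvPolynomial (Vars V) K)) : Ideal (MvPolynomial (Vars V) K) :=
  leadingMonomialIdeal K (I.map (genericChange K V))

/-- The binomial edge ideal `J_G = (x_i y_j - x_j y_i : {i, j} ∈ E(G))`. -/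
def binomialEdgeIdeal (K : Type*) {V : Type*} [Field K] (G : SimpleGraph V) :
    Ideal (MvPolynomial (Vars V) K) :=
  Ideal.span {p | ∃ i j, G.Adj i j ∧ p = X (xIdx i) * X (yIdx j) - X (xIdx j) * X (yIdx i)}

/-- The symbolic power `P^{(m)} = {r : r q ∈ P^m for some q ∉ P}` of a prime ideal. -/
def primeSymbolicPower {R : Type*} [CommRing R] (P : Ideal R) (hP : P.IsPrime) (m : ℕ) :
    Ideal R where
  carrier := {r | ∃ q, q ∉ P ∧ r * q ∈ P ^ m}
  zero_mem' := ⟨1, fun h => hP.ne_top ((Ideal.eq_top_iff_one P).2 h), by simp⟩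
  add_mem' := by
    rintro r s ⟨q, hq, hrq⟩ ⟨q', hq', hsq'⟩
    refine ⟨q * q', fun h => (hP.mem_or_mem h).elim hq hq', ?_⟩
    have h1 := (P ^ m).mul_mem_right q' hrq
    have h2 := (P ^ m).mul_mem_right q hsq'
    have h3 : (r + s) * (q * q') = r * q * q' + s * q' * q := by ring
    rw [h3]
    exact (P ^ m).add_mem h1 h2
  smul_mem' := by
    rintro c r ⟨q, hq, hrq⟩
    refine ⟨q, hq, ?_⟩
    have h1 := (P ^ m).mul_mem_left c hrq
    rwa [← mul_assoc] at h1

/-- The symbolic power `I^{(m)} = ⋂ P^{(m)}`, `P` running over the minimal primes of the radical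
ideal `I`. -/
def symbolicPower {R : Type*} [CommRing R] (I : Ideal R) (m : ℕ) : Ideal R :=
  ⨅ P : I.minimalPrimes, primeSymbolicPower P.1 P.2.1.1 m

/-- The symbolic polyhedron `SP(I) = conv {a / q : q ≥ 1, x^a ∈ I^{(q)}}`. -/
def symbolicPolyhedron {K σ : Type*} [Field K] (I : Ideal (MvPolynomial σ K)) : Set (σ → ℝ) :=
  convexHull ℝ {p | ∃ (q : ℕ) (a : σ →₀ ℕ), 1 ≤ q ∧ monomial a (1 : K) ∈ symbolicPower I q ∧
    p = fun k => (a k : ℝ) / (q : ℝ)}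

/-- The set of vertices of the symbolic polyhedron. -/
def spVertices {K σ : Type*} [Field K] (I : Ideal (MvPolynomial σ K)) : Set (σ → ℝ) :=
  Set.extremePoints ℝ (symbolicPolyhedron I)

open Classical in
/-- The canonical inclusion `ℝ^{2|W|} → ℝ^{2|V|}` for a set of vertices `W ⊆ V`: the coordinates at
vertices outside `W` are zero. -/
def canonicalInclusion {V : Type*} (W : Set V) (a : Vars W → ℝ) : Vars V → ℝ :=
  fun k => match ofLex k with
    | Sum.inl v => if h : v ∈ W then a (xIdx ⟨v, h⟩) else 0
    | Sum.inr v => if h : v ∈ W then a (yIdx ⟨v, h⟩) else 0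

end

/-! Both `in` and `gin` are monomial ideals, spanned by the leading exponents of an ideal. The
minimal primes of a monomial ideal are generated by sets `T` of variables meeting every exponent's
support (covers), so a monomial lies in the `q`-th symbolic power iff it has weight at least `q` on
every cover. Clearing denominators, the symbolic polyhedron is the convex hull of the nonnegative
rational points of weight at least one on every cover (`symbolicPolyhedron_monomialSpan`).

The ideal of `G` is the sum of the extended ideals of its components, which use disjoint sets of
variables. Each leading exponent of the sum restricts to a leading exponent in some block
(`exists_exponentPart_mem_leadingExponents`), so a cover is exactly an independent choice of a cover
in every block.

Hence the minimal cover weight of a point is the sum of its minimal weights in the blocks. A point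
with a block of positive minimal weight splits as a convex combination of a point on that block and
another cover point. For a vertex this forces its support into a single block
(`exists_block_of_mem_extremePoints`). Conversely, points supported on one block form a face, so
vertices of a block remain vertices. -/

/-- The total weight of `p` on the set `T`. -/
noncomputable def weightOn {σ R : Type*} [Fintype σ] [AddCommMonoid R] (T : Set σ) (p : σ → R) : R :=
  ∑ k, T.indicator p k

/-- The nonnegative rational points having weight at least one on every member of `C`. -/
def rationalCoverPoints {σ : Type*} [Fintype σ] (C : Set (Set σ)) : Set (σ → ℝ) :=
  {p | (∀ k, 0 ≤ p k ∧ p k ∈ (algebraMap ℚ ℝ).fieldRange) ∧ ∀ T ∈ C, 1 ≤ weightOn T p}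

/-! ### Vertices of cover polyhedra over disjoint blocks. -/

section Blocks

variable {ι σ : Type*} {τ : ι → Type*} (E : (Σ c, τ c) ≃ σ)

/-- The part of `T` lying in the block `c`. -/
def blockPart (c : ι) (T : Set σ) : Set (τ c) := {j | E ⟨c, j⟩ ∈ T}

/-- Extension by zero from the block `c`. -/
noncomputable def blockExtend (c : ι) (p : τ c → ℝ) : σ → ℝ :=
  Function.extend (fun j => E ⟨c, j⟩) p 0

theorem block_injective (c : ι) : Function.Injective fun j : τ c => E ⟨c, j⟩ := fun i j h => by
  simpa using h

theorem block_funext {R : Type*} {p q : σ → R} (h : ∀ c j, p (E ⟨c, j⟩) = q (E ⟨c, j⟩)) :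
    p = q := by
  funext k
  obtain ⟨⟨c, j⟩, rfl⟩ := E.surjective k
  exact h c j

@[simp] theorem blockExtend_same (c : ι) (p : τ c → ℝ) (j : τ c) :
    blockExtend E c p (E ⟨c, j⟩) = p j :=
  (block_injective E c).extend_apply p 0 j

theorem blockExtend_ne {c d : ι} (h : d ≠ c) (p : τ c → ℝ) (j : τ d) :
    blockExtend E c p (E ⟨d, j⟩) = 0 := by
  refine Function.extend_apply' _ _ _ ?_
  rintro ⟨i, hi⟩
  exact h (congrArg Sigma.fst (E.injective hi)).symm

theorem blockExtend_injective (c : ι) : Function.Injective (blockExtend E c) := fun p q h => by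
  funext j
  simpa using congrFun h (E ⟨c, j⟩)

theorem blockExtend_combination (c : ι) (a b : ℝ) (p q : τ c → ℝ) :
    blockExtend E c (a • p + b • q) = a • blockExtend E c p + b • blockExtend E c q := by
  refine block_funext E fun d j => ?_
  by_cases h : d = c
  · subst h; simp
  · simp [blockExtend_ne E h]

variable [Fintype ι] [Fintype σ] [∀ c, Fintype (τ c)]

theorem weightOn_eq_sum {R : Type*} [AddCommMonoid R] (T : Set σ) (p : σ → R) :
    weightOn T p = ∑ c, weightOn (blockPart E c T) fun j => p (E ⟨c, j⟩) := by
  classical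
  unfold weightOn
  rw [← E.sum_comp, Fintype.sum_sigma]
  refine Finset.sum_congr rfl fun c _ => Finset.sum_congr rfl fun j _ => ?_
  simp [Set.indicator_apply, blockPart]

theorem weightOn_mono {σ : Type*} [Fintype σ] (T : Set σ) {p q : σ → ℝ} (h : ∀ k, p k ≤ q k) :
    weightOn T p ≤ weightOn T q :=
  Finset.sum_le_sum fun k _ => Set.indicator_le_indicator (h k)

theorem weightOn_div {σ : Type*} [Fintype σ] (T : Set σ) (p : σ → ℝ) (r : ℝ) :
    (weightOn T fun k => p k / r) = weightOn T p / r := by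
  classical
  unfold weightOn
  rw [Finset.sum_div]
  refine Finset.sum_congr rfl fun k _ => ?_
  by_cases h : k ∈ T <;> simp [h]

theorem weightOn_zero {σ : Type*} [Fintype σ] (T : Set σ) : (weightOn T fun _ => (0 : ℝ)) = 0 := by
  simp [weightOn]

theorem weightOn_mem {σ : Type*} [Fintype σ] (T : Set σ) {p : σ → ℝ} (S : Subfield ℝ)
    (h : ∀ k, p k ∈ S) : weightOn T p ∈ S := by
  classical
  refine sum_mem fun k _ => ?_
  rw [Set.indicator_apply]
  split_ifs
  exacts [h k, S.zero_mem]

theorem weightOn_blockExtend (c : ι) (T : Set σ) (p : τ c → ℝ) :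
    weightOn T (blockExtend E c p) = weightOn (blockPart E c T) p := by
  classical
  rw [weightOn_eq_sum E, Finset.sum_eq_single c]
  · simp
  · intro d _ h
    simp only [blockExtend_ne E h, weightOn_zero]
  · simp

theorem rationalCoverPoints_ne_zero {σ : Type*} [Fintype σ] {C : Set (Set σ)} (hC : C.Nonempty)
    {p : σ → ℝ} (hp : p ∈ rationalCoverPoints C) : p ≠ 0 := by
  rintro rfl
  obtain ⟨T, hT⟩ := hC
  have := hp.2 T hT
  have h0 : weightOn T (0 : σ → ℝ) = 0 := weightOn_zero T
  linarith

variable {C : Set (Set σ)} {D : ∀ c, Set (Set (τ c))}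

theorem blockExtend_mem_rationalCoverPoints
    (hC : ∀ T, T ∈ C ↔ ∀ c, blockPart E c T ∈ D c) (c : ι) {p : τ c → ℝ}
    (hp : p ∈ rationalCoverPoints (D c)) : blockExtend E c p ∈ rationalCoverPoints C := by
  refine ⟨fun k => ?_, fun T hT => ?_⟩
  · obtain ⟨⟨d, j⟩, rfl⟩ := E.surjective k
    by_cases h : d = c
    · subst h; simpa using hp.1 j
    · simpa only [blockExtend_ne E h] using ⟨le_refl _, Subfield.zero_mem _⟩
  · rw [weightOn_blockExtend]
    exact hp.2 _ ((hC T).1 hT c)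

theorem blockExtend_mem_convexHull
    (hC : ∀ T, T ∈ C ↔ ∀ c, blockPart E c T ∈ D c) (c : ι) {p : τ c → ℝ}
    (hp : p ∈ convexHull ℝ (rationalCoverPoints (D c))) :
    blockExtend E c p ∈ convexHull ℝ (rationalCoverPoints C) := by
  have key : convexHull ℝ (rationalCoverPoints (D c)) ⊆
      {p | blockExtend E c p ∈ convexHull ℝ (rationalCoverPoints C)} := by
    refine convexHull_min (fun p hp => subset_convexHull ℝ _
      (blockExtend_mem_rationalCoverPoints E hC c hp)) ?_
    intro x hx y hy a b ha hb hab
    rw [Set.mem_ofPred_eq, blockExtend_combination]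
    exact convex_convexHull ℝ _ hx hy ha hb hab
  exact key hp

/-- A set made of given parts in all blocks. -/
theorem exists_blockPart_eq {ι σ : Type*} {τ : ι → Type*} (E : (Σ c, τ c) ≃ σ)
    (T : ∀ c, Set (τ c)) : ∃ U : Set σ, ∀ c, blockPart E c U = T c :=
  ⟨{k | ∃ c, ∃ j ∈ T c, E ⟨c, j⟩ = k}, fun c => by
    ext j
    refine ⟨?_, fun h => ⟨c, j, h, rfl⟩⟩
    rintro ⟨d, i, hi, h⟩
    obtain ⟨rfl, h⟩ := Sigma.mk.inj (E.injective h)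
    obtain rfl := eq_of_heq h
    exact hi⟩

/-- Nonnegative points vanishing off block `c` form a face, so a proper convex combination lying
there has both ends there. Nonnegativity is proved in the same induction because this face argument
needs it. -/
theorem convexHull_restrict (hD : ∀ c, (D c).Nonempty)
    (hC : ∀ T, T ∈ C ↔ ∀ c, blockPart E c T ∈ D c) (c : ι) {u : σ → ℝ}
    (hu : u ∈ convexHull ℝ (rationalCoverPoints C)) :
    (∀ k, 0 ≤ u k) ∧ ((∀ d, d ≠ c → ∀ j, u (E ⟨d, j⟩) = 0) →
      (fun j => u (E ⟨c, j⟩)) ∈ convexHull ℝ (rationalCoverPoints (D c))) := by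
  classical
  have key : convexHull ℝ (rationalCoverPoints C) ⊆
      {u | (∀ k, 0 ≤ u k) ∧ ((∀ d, d ≠ c → ∀ j, u (E ⟨d, j⟩) = 0) →
        (fun j => u (E ⟨c, j⟩)) ∈ convexHull ℝ (rationalCoverPoints (D c)))} := by
    refine convexHull_min ?_ ?_
    · refine fun u hu => ⟨fun k => (hu.1 k).1, fun h0 => subset_convexHull ℝ _
        ⟨fun j => hu.1 _, fun T hT => ?_⟩⟩
      -- A cover `T` of the block is completed by arbitrary covers elsewhere, where `u` has weight
      -- zero.
      choose S hS using hD
      obtain ⟨U, hU⟩ := exists_blockPart_eq E (Function.update S c T)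
      have hUC : U ∈ C := by
        rw [hC]
        intro d
        rw [hU]
        by_cases h : d = c
        · subst h; simpa using hT
        · simpa [h] using hS d
      have h1 := hu.2 U hUC
      rw [weightOn_eq_sum E, Finset.sum_eq_single c] at h1
      · simpa [hU] using h1
      · intro d _ h
        simp only [h0 d h, weightOn_zero]
      · simp
    · rintro x ⟨hx, hx'⟩ y ⟨hy, hy'⟩ a b ha hb hab
      refine ⟨fun k => add_nonneg (mul_nonneg ha (hx k)) (mul_nonneg hb (hy k)), fun h0 => ?_⟩
      -- With a zero coefficient, that endpoint need not lie in the face, so this case is treated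
      -- separately.
      rcases ha.eq_or_lt with rfl | ha'
      · obtain rfl : b = 1 := by linarith
        simp only [zero_smul, one_smul, zero_add] at h0 ⊢
        exact hy' h0
      rcases hb.eq_or_lt with rfl | hb'
      · obtain rfl : a = 1 := by linarith
        simp only [zero_smul, one_smul, add_zero] at h0 ⊢
        exact hx' h0
      have hz : ∀ d, d ≠ c → ∀ j, x (E ⟨d, j⟩) = 0 ∧ y (E ⟨d, j⟩) = 0 := by
        intro d hd j
        have h := h0 d hd j
        simp only [Pi.add_apply, Pi.smul_apply, smul_eq_mul] at h
        have h1 := mul_nonneg ha (hx (E ⟨d, j⟩))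
        have h2 := mul_nonneg hb (hy (E ⟨d, j⟩))
        exact ⟨(mul_eq_zero.1 (by linarith : a * x (E ⟨d, j⟩) = 0)).resolve_left ha'.ne',
          (mul_eq_zero.1 (by linarith : b * y (E ⟨d, j⟩) = 0)).resolve_left hb'.ne'⟩
      exact convex_convexHull ℝ _ (hx' fun d hd j => (hz d hd j).1)
        (hy' fun d hd j => (hz d hd j).2) ha hb hab
  exact key hu

theorem blockExtend_mem_extremePoints (hD : ∀ c, (D c).Nonempty)
    (hC : ∀ T, T ∈ C ↔ ∀ c, blockPart E c T ∈ D c) (c : ι) {p : τ c → ℝ}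
    (hp : p ∈ Set.extremePoints ℝ (convexHull ℝ (rationalCoverPoints (D c)))) :
    blockExtend E c p ∈ Set.extremePoints ℝ (convexHull ℝ (rationalCoverPoints C)) := by
  rw [mem_extremePoints_iff_left] at hp ⊢
  refine ⟨blockExtend_mem_convexHull E hC c hp.1, fun u hu v hv huv => ?_⟩
  obtain ⟨a, b, ha, hb, hab, h⟩ := huv
  have hu' := convexHull_restrict E hD hC c hu
  have hv' := convexHull_restrict E hD hC c hv
  have hz : ∀ d, d ≠ c → ∀ j, u (E ⟨d, j⟩) = 0 ∧ v (E ⟨d, j⟩) = 0 := by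
    intro d hd j
    have h := congrFun h (E ⟨d, j⟩)
    rw [blockExtend_ne E hd] at h
    simp only [Pi.add_apply, Pi.smul_apply, smul_eq_mul] at h
    have h1 := mul_nonneg ha.le (hu'.1 (E ⟨d, j⟩))
    have h2 := mul_nonneg hb.le (hv'.1 (E ⟨d, j⟩))
    exact ⟨(mul_eq_zero.1 (by linarith : a * u (E ⟨d, j⟩) = 0)).resolve_left ha.ne',
      (mul_eq_zero.1 (by linarith : b * v (E ⟨d, j⟩) = 0)).resolve_left hb.ne'⟩
  have h1 := hp.2 _ (hu'.2 fun d hd j => (hz d hd j).1) _ (hv'.2 fun d hd j => (hz d hd j).2)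
    ⟨a, b, ha, hb, hab, by
      funext j
      have := congrFun h (E ⟨c, j⟩)
      simpa using this⟩
  refine block_funext E fun d j => ?_
  by_cases hd : d = c
  · subst hd
    simpa using congrFun h1 j
  · rw [(hz d hd j).1, blockExtend_ne E hd]

/-- Every vertex is supported on a single block. -/
theorem exists_block_of_mem_extremePoints (hD : ∀ c, (D c).Nonempty)
    (hC : ∀ T, T ∈ C ↔ ∀ c, blockPart E c T ∈ D c) {p : σ → ℝ}
    (hp : p ∈ Set.extremePoints ℝ (convexHull ℝ (rationalCoverPoints C))) :
    ∃ c, (fun j => p (E ⟨c, j⟩)) ∈ rationalCoverPoints (D c) ∧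
      p = blockExtend E c fun j => p (E ⟨c, j⟩) := by
  classical
  have hpR : p ∈ rationalCoverPoints C := extremePoints_convexHull_subset hp
  -- Covers of minimal weight in the blocks unite to a cover of total weight at least one, so some
  -- block has positive minimal weight `l`.
  have hmin : ∀ c, ∃ T ∈ D c, ∀ U ∈ D c,
      weightOn T (fun j => p (E ⟨c, j⟩)) ≤ weightOn U fun j => p (E ⟨c, j⟩) :=
    fun c => Set.exists_min_image (D c) _ (Set.toFinite _) (hD c)
  choose S hS hSmin using hmin
  obtain ⟨U, hU⟩ := exists_blockPart_eq E S
  have hUC : U ∈ C := (hC U).2 fun c => by rw [hU]; exact hS c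
  have h1 := hpR.2 U hUC
  rw [weightOn_eq_sum E] at h1
  simp only [hU] at h1
  obtain ⟨c, -, hc⟩ : ∃ c ∈ Finset.univ, 0 < weightOn (S c) fun j => p (E ⟨c, j⟩) := by
    by_contra! hcon
    have := Finset.sum_nonpos hcon
    linarith
  set l := weightOn (S c) fun j => p (E ⟨c, j⟩) with hl
  set pc : τ c → ℝ := fun j => p (E ⟨c, j⟩) with hpc
  -- Rationality of `l` keeps the rescaled points below among the generators of the hull.
  have hlS : l ∈ (algebraMap ℚ ℝ).fieldRange := weightOn_mem _ _ fun j => (hpR.1 _).2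
  set q := blockExtend E c pc with hq
  have hqp : ∀ k, 0 ≤ q k ∧ q k ≤ p k ∧ q k ∈ (algebraMap ℚ ℝ).fieldRange := by
    intro k
    obtain ⟨⟨d, j⟩, rfl⟩ := E.surjective k
    by_cases h : d = c
    · subst h
      rw [hq, blockExtend_same]
      exact ⟨(hpR.1 _).1, le_refl _, (hpR.1 _).2⟩
    · rw [hq, blockExtend_ne E h]
      exact ⟨le_refl _, (hpR.1 _).1, Subfield.zero_mem _⟩
  rw [mem_extremePoints] at hp
  rcases le_or_gt 1 l with hl1 | hl1
  · have hpcR : pc ∈ rationalCoverPoints (D c) :=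
      ⟨fun j => hpR.1 _, fun T hT => hl1.trans (hSmin c T hT)⟩
    refine ⟨c, hpcR, ?_⟩
    have hqR : q ∈ rationalCoverPoints C := blockExtend_mem_rationalCoverPoints E hC c hpcR
    -- Here `p` is the midpoint of `q` and `2p - q ≥ p`, so extremality gives `p = q`.
    have hrR : (fun k => p k + (p k - q k)) ∈ rationalCoverPoints C := by
      refine ⟨fun k => ⟨by linarith [(hqp k).1, (hqp k).2.1], Subfield.add_mem _ (hpR.1 k).2
        (Subfield.sub_mem _ (hpR.1 k).2 (hqp k).2.2)⟩, fun T hT => (hpR.2 T hT).trans ?_⟩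
      exact weightOn_mono T fun k => by linarith [(hqp k).2.1]
    refine (hp.2 _ (subset_convexHull ℝ _ hqR) _ (subset_convexHull ℝ _ hrR) ?_).1.symm
    refine ⟨1 / 2, 1 / 2, by norm_num, by norm_num, by norm_num, ?_⟩
    funext k
    simp only [Pi.add_apply, Pi.smul_apply, smul_eq_mul]
    ring
  · exfalso
    -- Now `p = l • (q / l) + (1 - l) • ((p - q) / (1 - l))`. The two points have disjoint supports,
    -- so if both equal `p` then `p = 0`.
    have hl' : 0 < 1 - l := by linarith
    have hqR : (fun k => q k / l) ∈ rationalCoverPoints C := by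
      refine ⟨fun k => ⟨div_nonneg (hqp k).1 hc.le, Subfield.div_mem _ (hqp k).2.2 hlS⟩,
        fun T hT => ?_⟩
      rw [weightOn_div, hq, weightOn_blockExtend, le_div_iff₀ hc, one_mul]
      exact hSmin c _ ((hC T).1 hT c)
    have hrR : (fun k => (p k - q k) / (1 - l)) ∈ rationalCoverPoints C := by
      refine ⟨fun k => ⟨div_nonneg (by linarith [(hqp k).2.1]) hl'.le, Subfield.div_mem _
        (Subfield.sub_mem _ (hpR.1 k).2 (hqp k).2.2)
        (Subfield.sub_mem _ (Subfield.one_mem _) hlS)⟩, fun T hT => ?_⟩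
      rw [weightOn_div, le_div_iff₀ hl', one_mul]
      -- Replacing the part of `T` in block `c` by `S c` gives a cover on which `p` has weight `l`
      -- plus the weight of `p - q` on `T`.
      obtain ⟨U, hU⟩ := exists_blockPart_eq E
        (Function.update (fun d => blockPart E d T) c (S c))
      have hUC : U ∈ C := by
        rw [hC]
        intro d
        rw [hU]
        by_cases h : d = c
        · subst h; simpa using hS d
        · simpa [h] using (hC T).1 hT d
      have h2 := hpR.2 U hUC
      rw [weightOn_eq_sum E, ← Finset.add_sum_erase _ _ (Finset.mem_univ c)] at h2
      rw [weightOn_eq_sum E, ← Finset.add_sum_erase _ _ (Finset.mem_univ c)]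
      have h3 : weightOn (blockPart E c U) (fun j => p (E ⟨c, j⟩)) = l := by
        rw [hU, Function.update_self]
      have h4 : (weightOn (blockPart E c T) fun j => p (E ⟨c, j⟩) - q (E ⟨c, j⟩)) = 0 := by
        simp only [hq, blockExtend_same, hpc, sub_self, weightOn_zero]
      have h5 : ∀ d ∈ Finset.univ.erase c,
          weightOn (blockPart E d U) (fun j => p (E ⟨d, j⟩)) =
            weightOn (blockPart E d T) fun j => p (E ⟨d, j⟩) - q (E ⟨d, j⟩) := by
        intro d hd
        have hd' := Finset.ne_of_mem_erase hd
        simp only [hU, Function.update_of_ne hd', hq, blockExtend_ne E hd', sub_zero]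
      rw [Finset.sum_congr rfl h5, h3] at h2
      rw [h4]
      linarith
    obtain ⟨h2, h3⟩ := hp.2 _ (subset_convexHull ℝ _ hqR) _ (subset_convexHull ℝ _ hrR)
      ⟨l, 1 - l, hc, hl', by ring, by
        funext k
        simp only [Pi.add_apply, Pi.smul_apply, smul_eq_mul]
        field_simp
        ring⟩
    refine rationalCoverPoints_ne_zero ⟨U, hUC⟩ hpR (block_funext E fun d j => ?_)
    by_cases h : d = c
    · subst h
      have := congrFun h3 (E ⟨d, j⟩)
      simp only [hq, blockExtend_same, hpc, sub_self, zero_div] at this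
      exact this.symm
    · have := congrFun h2 (E ⟨d, j⟩)
      simp only [hq, blockExtend_ne E h, zero_div] at this
      exact this.symm

theorem extremePoints_rationalCoverPoints (hD : ∀ c, (D c).Nonempty)
    (hC : ∀ T, T ∈ C ↔ ∀ c, blockPart E c T ∈ D c) :
    Set.extremePoints ℝ (convexHull ℝ (rationalCoverPoints C)) =
      ⋃ c, blockExtend E c '' Set.extremePoints ℝ (convexHull ℝ (rationalCoverPoints (D c))) := by
  ext p
  simp only [Set.mem_iUnion, Set.mem_image]
  constructor
  · intro hp
    obtain ⟨c, hc, hpc⟩ := exists_block_of_mem_extremePoints E hD hC hp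
    refine ⟨c, _, ?_, hpc.symm⟩
    rw [hpc, mem_extremePoints_iff_left] at hp
    rw [mem_extremePoints_iff_left]
    refine ⟨subset_convexHull ℝ _ hc, fun x hx y hy hxy => blockExtend_injective E c ?_⟩
    refine hp.2 _ (blockExtend_mem_convexHull E hC c hx) _
      (blockExtend_mem_convexHull E hC c hy) ?_
    obtain ⟨a, b, ha, hb, hab, h⟩ := hxy
    exact ⟨a, b, ha, hb, hab, by rw [← h, blockExtend_combination]⟩
  · rintro ⟨c, q, hq, rfl⟩
    exact blockExtend_mem_extremePoints E hD hC c hq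

end Blocks

theorem pairwise_disjoint_blockExtend {ι σ : Type*} {τ : ι → Type*} [∀ c, Fintype (τ c)]
    (E : (Σ c, τ c) ≃ σ) {D : ∀ c, Set (Set (τ c))} (hD : ∀ c, (D c).Nonempty) :
    Pairwise fun c d => Disjoint
      (blockExtend E c '' Set.extremePoints ℝ (convexHull ℝ (rationalCoverPoints (D c))))
      (blockExtend E d '' Set.extremePoints ℝ (convexHull ℝ (rationalCoverPoints (D d)))) := by
  intro c d hcd
  rw [Set.disjoint_left]
  rintro _ ⟨p, hp, rfl⟩ ⟨q, hq, h⟩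
  refine rationalCoverPoints_ne_zero (hD c) (extremePoints_convexHull_subset hp) ?_
  funext j
  have := congrFun h (E ⟨c, j⟩)
  rw [blockExtend_ne E hcd, blockExtend_same] at this
  exact this.symm

/-! ### Symbolic powers of monomial ideals. -/

/-- The sets of variables meeting the support of every exponent in `A`. -/
def exponentCovers {σ : Type*} (A : Set (σ →₀ ℕ)) : Set (Set σ) := {T | ∀ a ∈ A, ∃ k ∈ T, a k ≠ 0}

/-- The monomial ideal with exponents in `A`. -/
noncomputable def monomialSpan (K : Type*) {σ : Type*} [Field K] (A : Set (σ →₀ ℕ)) :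
    Ideal (MvPolynomial σ K) :=
  Ideal.span ((fun a => monomial a 1) '' A)

section MonomialIdeals

variable {K σ : Type*} [Field K]

theorem isPrime_span_X_image (T : Set σ) :
    (Ideal.span (X '' T : Set (MvPolynomial σ K))).IsPrime := by
  classical
  let φ : MvPolynomial σ K →ₐ[K] MvPolynomial σ K := aeval fun k => if k ∈ T then 0 else X k
  have h : Ideal.span (X '' T : Set (MvPolynomial σ K)) = RingHom.ker φ := by
    apply le_antisymm
    · rw [Ideal.span_le]
      rintro _ ⟨k, hk, rfl⟩
      simp [φ, hk]
    · intro f hf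
      set P := Ideal.span (X '' T : Set (MvPolynomial σ K)) with hP
      have hc : (Ideal.Quotient.mkₐ K P).comp φ = Ideal.Quotient.mkₐ K P := by
        refine algHom_ext fun k => ?_
        by_cases hk : k ∈ T
        · have : (X k : MvPolynomial σ K) ∈ P := Ideal.subset_span ⟨k, hk, rfl⟩
          simp [φ, hk, Ideal.Quotient.eq_zero_iff_mem.2 this]
        · simp [φ, hk]
      have h1 := AlgHom.congr_fun hc f
      rw [AlgHom.comp_apply, (RingHom.mem_ker).1 hf, map_zero] at h1
      exact Ideal.Quotient.eq_zero_iff_mem.1 h1.symm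
  rw [h]
  exact RingHom.ker_isPrime _

theorem monomial_mem_prime {P : Ideal (MvPolynomial σ K)} (hP : P.IsPrime) {a : σ →₀ ℕ}
    (ha : monomial a (1 : K) ∈ P) : ∃ k, a k ≠ 0 ∧ X k ∈ P := by
  rw [monomial_eq, C_1, one_mul, Finsupp.prod, hP.prod_mem_iff] at ha
  obtain ⟨k, hk, h⟩ := ha
  exact ⟨k, Finsupp.mem_support_iff.1 hk, hP.mem_of_pow_mem _ h⟩

theorem monomialSpan_le_iff (A : Set (σ →₀ ℕ)) (T : Set σ) :
    monomialSpan K A ≤ Ideal.span (X '' T) ↔ T ∈ exponentCovers A := by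
  rw [monomialSpan, Ideal.span_le, Set.image_subset_iff]
  refine forall₂_congr fun a _ => ?_
  rw [Set.mem_preimage, SetLike.mem_coe, mem_ideal_span_X_image]
  classical
  simp [support_monomial]

/-- The variables in `P` already generate a prime containing the monomial ideal and contained in
`P`, so minimality gives equality. -/
theorem minimalPrimes_monomialSpan {A : Set (σ →₀ ℕ)} {P : Ideal (MvPolynomial σ K)}
    (hP : P ∈ (monomialSpan K A).minimalPrimes) :
    ∃ T ∈ exponentCovers A, P = Ideal.span (X '' T) := by
  have hT : {k | X k ∈ P} ∈ exponentCovers A := fun a ha => by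
    obtain ⟨k, h1, h2⟩ := monomial_mem_prime hP.1.1 (hP.1.2 (Ideal.subset_span ⟨a, ha, rfl⟩))
    exact ⟨k, h2, h1⟩
  have hle : Ideal.span (X '' {k | X k ∈ P}) ≤ P := by
    rw [Ideal.span_le]
    rintro _ ⟨k, hk, rfl⟩
    exact hk
  exact ⟨_, hT, le_antisymm
    (hP.2 ⟨isPrime_span_X_image _, (monomialSpan_le_iff A _).2 hT⟩ hle) hle⟩

variable [Fintype σ]

theorem weightOn_finsupp_add (T : Set σ) (a b : σ →₀ ℕ) :
    weightOn T (a + b : σ →₀ ℕ) = weightOn T a + weightOn T b := by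
  simp [weightOn, Set.indicator_add', Finset.sum_add_distrib]

theorem le_weightOn_of_mem_pow (T : Set σ) (q : ℕ) {f : MvPolynomial σ K}
    (hf : f ∈ Ideal.span (X '' T) ^ q) : ∀ m ∈ f.support, q ≤ weightOn T m := by
  classical
  induction q generalizing f with
  | zero => exact fun m _ => Nat.zero_le _
  | succ q ih =>
    rw [pow_succ] at hf
    refine Submodule.mul_induction_on hf ?_ ?_
    · intro g hg h hh m hm
      obtain ⟨m₁, h₁, m₂, h₂, rfl⟩ := Finset.mem_add.1 (support_mul g h hm)
      obtain ⟨k, hk, hk'⟩ := mem_ideal_span_X_image.1 hh m₂ h₂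
      rw [weightOn_finsupp_add]
      have h3 : 1 ≤ weightOn T m₂ := by
        refine le_trans ?_ (Finset.single_le_sum (f := fun k => T.indicator m₂ k)
          (fun _ _ => Nat.zero_le _) (Finset.mem_univ k))
        rw [Set.indicator_of_mem hk]
        omega
      have := ih hg m₁ h₁
      omega
    · intro g h hg hh m hm
      rcases Finset.mem_union.1 (support_add hm) with h | h
      exacts [hg m h, hh m h]

theorem monomial_mem_pow (T : Set σ) (a : σ →₀ ℕ) :
    monomial a (1 : K) ∈ Ideal.span (X '' T) ^ weightOn T a := by
  classical
  have h : monomial a (1 : K) = ∏ k, X k ^ a k := by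
    rw [monomial_eq, C_1, one_mul, Finsupp.prod_fintype]
    simp
  rw [h, weightOn, ← Finset.prod_pow_eq_pow_sum]
  refine Ideal.prod_mem_prod fun k _ => ?_
  by_cases hk : k ∈ T
  · rw [Set.indicator_of_mem hk]
    have h1 : (X k : MvPolynomial σ K) ∈ Ideal.span (X '' T) := Ideal.subset_span ⟨k, hk, rfl⟩
    exact Ideal.pow_mem_pow h1 _
  · simp [hk]

theorem monomial_mem_primeSymbolicPower_iff (T : Set σ) (q : ℕ) (a : σ →₀ ℕ) :
    monomial a (1 : K) ∈ primeSymbolicPower (Ideal.span (X '' T)) (isPrime_span_X_image T) q ↔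
      q ≤ weightOn T a := by
  constructor
  · rintro ⟨s, hs, has⟩
    rw [mem_ideal_span_X_image] at hs
    push Not at hs
    obtain ⟨m, hm, hmT⟩ := hs
    -- A multiplier outside the prime has a term `m` free of variables in `T`, so `a + m` has the
    -- weight of `a`.
    have h0 : weightOn T m = 0 := Finset.sum_eq_zero fun k _ => by
      by_cases hk : k ∈ T
      · rw [Set.indicator_of_mem hk, hmT k hk]
      · exact Set.indicator_of_notMem hk _
    have := le_weightOn_of_mem_pow T q has (a + m) (by
      rw [mem_support_iff, coeff_monomial_mul, one_mul]
      exact mem_support_iff.1 hm)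
    rwa [weightOn_finsupp_add, h0, add_zero] at this
  · intro h
    refine ⟨1, (Ideal.ne_top_iff_one _).1 (isPrime_span_X_image T).ne_top, ?_⟩
    rw [mul_one]
    exact Ideal.pow_le_pow_right h (monomial_mem_pow T a)

theorem weightOn_le_of_subset {S T : Set σ} (h : S ⊆ T) (a : σ → ℕ) :
    weightOn S a ≤ weightOn T a :=
  Finset.sum_le_sum fun _ _ => Set.indicator_le_indicator_of_subset h (fun _ => Nat.zero_le _) _

/-- Symbolic powers of monomial ideals in terms of covers. -/
theorem monomial_mem_symbolicPower_iff (A : Set (σ →₀ ℕ)) (q : ℕ) (a : σ →₀ ℕ) :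
    monomial a (1 : K) ∈ symbolicPower (monomialSpan K A) q ↔
      ∀ T ∈ exponentCovers A, q ≤ weightOn T a := by
  classical
  rw [symbolicPower, Submodule.mem_iInf]
  constructor
  · intro h T hT
    have := isPrime_span_X_image (K := K) T
    -- `T` need not be minimal, but a minimal prime below it yields a cover `S ⊆ T`, and weights are
    -- monotone.
    obtain ⟨P, hP, hPT⟩ := Ideal.exists_minimalPrimes_le ((monomialSpan_le_iff (K := K) A T).2 hT)
    obtain ⟨S, hS, rfl⟩ := minimalPrimes_monomialSpan hP
    refine ((monomial_mem_primeSymbolicPower_iff S q a).1 (h ⟨_, hP⟩)).trans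
      (weightOn_le_of_subset (fun k hk => ?_) a)
    have h1 := mem_ideal_span_X_image.1 (hPT (Ideal.subset_span ⟨k, hk, rfl⟩)) (Finsupp.single k 1)
      (by rw [X, mem_support_iff, coeff_monomial, if_pos rfl]; exact one_ne_zero)
    obtain ⟨i, hi, hi'⟩ := h1
    rwa [(Finsupp.single_apply_ne_zero.1 hi').1] at hi
  · rintro h ⟨P, hP⟩
    obtain ⟨S, hS, rfl⟩ := minimalPrimes_monomialSpan hP
    exact (monomial_mem_primeSymbolicPower_iff S q a).2 (h S hS)

theorem weightOn_natCast_div (T : Set σ) (a : σ → ℕ) (q : ℝ) :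
    (weightOn T fun k => (a k : ℝ) / q) = (weightOn T a : ℕ) / q := by
  classical
  rw [weightOn_div]
  simp [weightOn, Set.indicator_apply]

/-- The points `a / q` spanning the symbolic polyhedron of a monomial ideal. -/
theorem symbolicPolyhedron_monomialSpan (A : Set (σ →₀ ℕ)) :
    symbolicPolyhedron (monomialSpan K A) =
      convexHull ℝ (rationalCoverPoints (exponentCovers A)) := by
  classical
  unfold symbolicPolyhedron
  congr 1
  ext p
  simp only [monomial_mem_symbolicPower_iff, Set.mem_ofPred_eq]
  constructor
  · rintro ⟨q, a, hq, ha, rfl⟩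
    have hq' : (0 : ℝ) < q := by exact_mod_cast hq
    refine ⟨fun k => ⟨by positivity, (a k : ℚ) / q, by simp⟩, fun T hT => ?_⟩
    rw [weightOn_natCast_div, le_div_iff₀ hq', one_mul]
    exact_mod_cast ha T hT
  · rintro ⟨h1, h2⟩
    choose h0 r hr using h1
    have hr0 : ∀ k, 0 ≤ r k := fun k => by
      have := h0 k
      rw [← hr k] at this
      simpa using this
    -- A common denominator of the coordinates.
    let q : ℕ := ∏ k, (r k).den
    have hq : 0 < q := Finset.prod_pos fun k _ => (r k).den_pos
    have hq' : (0 : ℝ) < q := by exact_mod_cast hq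
    have hex : ∀ k, ∃ m : ℕ, (m : ℝ) = p k * q := fun k => by
      refine ⟨(r k).num.toNat * ∏ i ∈ Finset.univ.erase k, (r i).den, ?_⟩
      have e1 : q = (r k).den * ∏ i ∈ Finset.univ.erase k, (r i).den :=
        (Finset.mul_prod_erase _ _ (Finset.mem_univ k)).symm
      have e2 : (((r k).num.toNat : ℕ) : ℝ) = p k * (r k).den := by
        have h3 : (((r k).num.toNat : ℕ) : ℚ) = r k * (r k).den := by
          rw [Rat.mul_den_eq_num]
          exact_mod_cast congrArg (Int.cast : ℤ → ℚ)
            (Int.toNat_of_nonneg (Rat.num_nonneg.2 (hr0 k)))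
        rw [← hr k]
        rw [eq_ratCast]
        exact_mod_cast congrArg (Rat.cast : ℚ → ℝ) h3
      rw [e1]
      push_cast
      rw [e2]
      ring
    choose m hm using hex
    have hp : p = fun k => (m k : ℝ) / q := by
      funext k
      rw [hm, mul_div_assoc, div_self hq'.ne', mul_one]
    refine ⟨q, Finsupp.equivFunOnFinite.symm m, hq, fun T hT => ?_, hp⟩
    have h3 := h2 T hT
    rw [hp, weightOn_natCast_div, le_div_iff₀ hq', one_mul] at h3
    exact_mod_cast h3

end MonomialIdeals

/-- The condition `0 ∉ B c` makes the set of all variables a cover. If `B c` is empty, the empty set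
is a cover too, and the block contributes no points. -/
theorem spVertices_monomialSpan_blocks {K ι σ : Type*} {τ : ι → Type*} [Field K] [Finite ι]
    [Finite σ] [∀ c, Finite (τ c)] (E : (Σ c, τ c) ≃ σ) {A : Set (σ →₀ ℕ)}
    {B : ∀ c, Set (τ c →₀ ℕ)} (hB : ∀ c, 0 ∉ B c)
    (hAB : ∀ T, T ∈ exponentCovers A ↔ ∀ c, blockPart E c T ∈ exponentCovers (B c)) :
    spVertices (monomialSpan K A) =
        ⋃ c, blockExtend E c '' spVertices (monomialSpan K (B c)) ∧
      Pairwise fun c d => Disjoint (blockExtend E c '' spVertices (monomialSpan K (B c)))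
        (blockExtend E d '' spVertices (monomialSpan K (B d))) := by
  have := Fintype.ofFinite ι
  have := Fintype.ofFinite σ
  have := fun c => Fintype.ofFinite (τ c)
  have hne : ∀ c, (exponentCovers (B c)).Nonempty := fun c => ⟨Set.univ, fun a ha => by
    obtain ⟨k, hk⟩ := Finsupp.ne_iff.1 (ne_of_mem_of_not_mem ha (hB c))
    exact ⟨k, trivial, hk⟩⟩
  simp only [spVertices, symbolicPolyhedron_monomialSpan]
  exact ⟨extremePoints_rationalCoverPoints E hne hAB, pairwise_disjoint_blockExtend E hne⟩

/-! ### Leading exponents of sums of ideals in disjoint variables. -/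

/-- The exponents of the leading monomials of the nonzero elements of `I`. -/
def leadingExponents {σ L : Type*} [Field L] (m : MonomialOrder σ) (I : Ideal (MvPolynomial σ L)) :
    Set (σ →₀ ℕ) := {a | ∃ f ∈ I, f ≠ 0 ∧ m.degree f = a}

open scoped MonomialOrder

theorem zero_notMem_leadingExponents {σ L : Type*} [Field L] (m : MonomialOrder σ)
    {I : Ideal (MvPolynomial σ L)} (hI : I ≤ RingHom.ker constantCoeff) :
    0 ∉ leadingExponents m I := by
  rintro ⟨f, hf, hf0, h⟩
  have h1 := m.coeff_degree_ne_zero_iff.2 hf0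
  rw [h] at h1
  exact h1 (hI hf)

/-- A non-leading exponent is detected by a linear functional vanishing on the ideal and on all
smaller monomials. -/
theorem exists_functional_of_notMem_leadingExponents {σ L : Type*} [Field L] (m : MonomialOrder σ)
    {I : Ideal (MvPolynomial σ L)} {a : σ →₀ ℕ} (ha : a ∉ leadingExponents m I) :
    ∃ φ : MvPolynomial σ L →ₗ[L] L, (∀ f ∈ I, φ f = 0) ∧
      (∀ b, b ≺[m] a → φ (monomial b 1) = 0) ∧ φ (monomial a 1) ≠ 0 := by
  classical
  -- If the monomial of `a` were `f + g` with `f ∈ I` and `g` a combination of smaller monomials,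
  -- then `f` would have leading exponent `a`.
  let p : Submodule L (MvPolynomial σ L) :=
    I.restrictScalars L ⊔ Submodule.span L ((fun b => monomial b 1) '' {b | b ≺[m] a})
  have hp : monomial a (1 : L) ∉ p := by
    intro h
    obtain ⟨f, hf, g, hg, hfg⟩ := Submodule.mem_sup.1 h
    have hg' : ∀ b, coeff b g ≠ 0 → b ≺[m] a := by
      refine Submodule.span_induction (p := fun g _ => ∀ b, coeff b g ≠ 0 → b ≺[m] a)
        ?_ ?_ ?_ ?_ hg
      · rintro _ ⟨b, hb, rfl⟩ b' hb'
        rw [coeff_monomial] at hb'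
        split_ifs at hb' with h
        · exact h ▸ hb
        · exact absurd rfl hb'
      · intro b hb
        exact absurd (coeff_zero b) hb
      · intro x y _ _ hx hy b hb
        by_cases h : coeff b x = 0
        · exact hy b (by simpa [h] using hb)
        · exact hx b h
      · intro r x _ hx b hb
        exact hx b fun h => hb (by rw [coeff_smul, h, smul_zero])
    have hga : coeff a g = 0 := by
      by_contra h
      exact lt_irrefl _ (hg' a h)
    have hfa : coeff a f = 1 := by
      have := congrArg (coeff a) hfg
      rwa [coeff_add, hga, add_zero, coeff_monomial, if_pos rfl] at this
    refine ha ⟨f, hf, fun h => ?_, m.toSyn.injective (le_antisymm ?_ ?_)⟩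
    · rw [h, coeff_zero] at hfa
      exact zero_ne_one hfa
    · rw [m.degree_le_iff]
      intro b hb
      by_cases hba : b = a
      · rw [hba]
      · refine (hg' b fun h => mem_support_iff.1 hb ?_).le
        have := congrArg (coeff b) hfg
        rwa [coeff_add, h, add_zero, coeff_monomial, if_neg (Ne.symm hba)] at this
    · exact m.le_degree (mem_support_iff.2 (by rw [hfa]; exact one_ne_zero))
  obtain ⟨φ, h1, h2⟩ := Submodule.exists_le_ker_of_notMem hp
  exact ⟨φ, fun f hf => h2 (Submodule.mem_sup_left hf), fun b hb =>
    h2 (Submodule.mem_sup_right (Submodule.subset_span ⟨b, hb, rfl⟩)), h1⟩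

section Blocks

variable {ι σ L : Type*} {τ F : ι → Type*} (E : (Σ c, τ c) ≃ σ) [Field L] [∀ c, Field (F c)]

/-- The part of an exponent in the block `c`. -/
noncomputable def exponentPart (c : ι) (a : σ →₀ ℕ) : τ c →₀ ℕ :=
  a.comapDomain (fun j => E ⟨c, j⟩) (block_injective E c).injOn

/-- An exponent of the block `c` seen as an exponent in all variables. -/
noncomputable def exponentExtend (c : ι) (a : τ c →₀ ℕ) : σ →₀ ℕ :=
  a.mapDomain fun j => E ⟨c, j⟩

@[simp] theorem exponentPart_apply (c : ι) (a : σ →₀ ℕ) (j : τ c) :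
    exponentPart E c a j = a (E ⟨c, j⟩) := rfl

@[simp] theorem exponentExtend_same (c : ι) (a : τ c →₀ ℕ) (j : τ c) :
    exponentExtend E c a (E ⟨c, j⟩) = a j :=
  Finsupp.mapDomain_apply (block_injective E c) a j

theorem exponentExtend_ne {c d : ι} (h : d ≠ c) (a : τ c →₀ ℕ) (j : τ d) :
    exponentExtend E c a (E ⟨d, j⟩) = 0 := by
  refine Finsupp.mapDomain_of_notMem_range _ _ ?_
  rintro ⟨i, hi⟩
  exact h (congrArg Sigma.fst (E.injective hi)).symm

theorem exponentPart_add_exponentExtend_same (c : ι) (a : σ →₀ ℕ) (b : τ c →₀ ℕ) :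
    exponentPart E c (a + exponentExtend E c b) = exponentPart E c a + b := by
  ext j
  simp

theorem exponentPart_add_exponentExtend_ne {c d : ι} (h : d ≠ c) (a : σ →₀ ℕ) (b : τ c →₀ ℕ) :
    exponentPart E d (a + exponentExtend E c b) = exponentPart E d a := by
  ext j
  simp [exponentExtend_ne E h]

theorem sum_exponentExtend_exponentPart [Fintype ι] (a : σ →₀ ℕ) :
    ∑ c, exponentExtend E c (exponentPart E c a) = a := by
  classical
  refine DFunLike.coe_injective (block_funext E fun c j => ?_)
  rw [Finsupp.finsetSum_apply, Finset.sum_eq_single c]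
  · simp
  · intro d _ h
    exact exponentExtend_ne E h.symm _ j
  · simp

/-- The ring homomorphism including the polynomial ring of a block, along an extension of the
coefficient field. -/
noncomputable def blockHom (ρ : ∀ c, F c →+* L) (c : ι) :
    MvPolynomial (τ c) (F c) →+* MvPolynomial σ L :=
  (rename fun j => E ⟨c, j⟩ : MvPolynomial (τ c) L →ₐ[L] MvPolynomial σ L).toRingHom.comp
    (map (ρ c))

variable (ρ : ∀ c, F c →+* L)

theorem blockHom_monomial (c : ι) (a : τ c →₀ ℕ) (r : F c) :
    blockHom E ρ c (monomial a r) = monomial (exponentExtend E c a) (ρ c r) := by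
  simp [blockHom, exponentExtend, rename_monomial]

theorem coeff_blockHom_exponentExtend (c : ι) (f : MvPolynomial (τ c) (F c)) (a : τ c →₀ ℕ) :
    coeff (exponentExtend E c a) (blockHom E ρ c f) = ρ c (coeff a f) := by
  simp [blockHom, exponentExtend, coeff_rename_mapDomain _ (block_injective E c), coeff_map]

theorem exists_of_coeff_blockHom_ne_zero (c : ι) (f : MvPolynomial (τ c) (F c)) {b : σ →₀ ℕ}
    (hb : coeff b (blockHom E ρ c f) ≠ 0) : ∃ a, exponentExtend E c a = b ∧ coeff a f ≠ 0 := by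
  obtain ⟨a, ha, h⟩ := coeff_rename_ne_zero _ _ _ hb
  refine ⟨a, ha, fun h0 => h ?_⟩
  rw [coeff_map, h0, map_zero]

variable (m : MonomialOrder σ) (mb : ∀ c, MonomialOrder (τ c))
  {I : Ideal (MvPolynomial σ L)} {J : ∀ c, Ideal (MvPolynomial (τ c) (F c))}

theorem exponentExtend_mem_leadingExponents
    (hm : ∀ c a b, a ≼[mb c] b → exponentExtend E c a ≼[m] exponentExtend E c b)
    (c : ι) (hIJ : (J c).map (blockHom E ρ c) ≤ I) {a : τ c →₀ ℕ}
    (ha : a ∈ leadingExponents (mb c) (J c)) :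
    exponentExtend E c a ∈ leadingExponents m I := by
  obtain ⟨f, hf, hf0, rfl⟩ := ha
  have h1 : coeff (exponentExtend E c ((mb c).degree f)) (blockHom E ρ c f) ≠ 0 := by
    rw [coeff_blockHom_exponentExtend]
    exact (map_ne_zero _).2 ((mb c).coeff_degree_ne_zero_iff.2 hf0)
  refine ⟨blockHom E ρ c f, hIJ (Ideal.mem_map_of_mem _ hf), fun h => h1 (by rw [h, coeff_zero]),
    m.toSyn.injective (le_antisymm ?_ (m.le_degree (mem_support_iff.2 h1)))⟩
  rw [m.degree_le_iff]
  intro b hb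
  obtain ⟨a, rfl, ha⟩ := exists_of_coeff_blockHom_ne_zero E ρ c f (mem_support_iff.1 hb)
  exact hm c _ _ ((mb c).le_degree (mem_support_iff.2 ha))

variable [Fintype ι]

/-- The tensor product of linear functionals on the blocks, after extension of scalars. -/
noncomputable def tensorFunctional (φ : ∀ c, MvPolynomial (τ c) (F c) →ₗ[F c] F c) :
    MvPolynomial σ L →ₗ[L] L :=
  (basisMonomials σ L).constr L fun a => ∏ c, ρ c (φ c (monomial (exponentPart E c a) 1))

theorem tensorFunctional_monomial (φ : ∀ c, MvPolynomial (τ c) (F c) →ₗ[F c] F c) (a : σ →₀ ℕ)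
    (r : L) : tensorFunctional E ρ φ (monomial a r) =
      r * ∏ c, ρ c (φ c (monomial (exponentPart E c a) 1)) := by
  have h : monomial a r = r • basisMonomials σ L a := by
    rw [coe_basisMonomials, smul_monomial, smul_eq_mul, mul_one]
  rw [h, map_smul, tensorFunctional, Module.Basis.constr_basis, smul_eq_mul]

/-- Multiplying by a polynomial of block `c` affects only the factor at `c`; hence functionals
killing the block ideals have a tensor product killing their sum. -/
theorem tensorFunctional_monomial_mul_blockHom [DecidableEq ι]
    (φ : ∀ c, MvPolynomial (τ c) (F c) →ₗ[F c] F c) (a : σ →₀ ℕ) (r : L) (c : ι)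
    (f : MvPolynomial (τ c) (F c)) :
    tensorFunctional E ρ φ (monomial a r * blockHom E ρ c f) =
      r * (ρ c (φ c (monomial (exponentPart E c a) 1 * f)) *
        ∏ d ∈ Finset.univ.erase c, ρ d (φ d (monomial (exponentPart E d a) 1))) := by
  induction f using MvPolynomial.induction_on' with
  | monomial b s =>
    rw [blockHom_monomial, monomial_mul, tensorFunctional_monomial,
      ← Finset.mul_prod_erase _ _ (Finset.mem_univ c), exponentPart_add_exponentExtend_same,
      monomial_mul, one_mul]
    have h1 : monomial (exponentPart E c a + b) s = s • monomial (exponentPart E c a + b) 1 := by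
      rw [smul_monomial, smul_eq_mul, mul_one]
    rw [h1, map_smul, smul_eq_mul, map_mul]
    rw [Finset.prod_congr rfl fun d hd => by
      rw [exponentPart_add_exponentExtend_ne E (Finset.ne_of_mem_erase hd)]]
    ring
  | add f g hf hg =>
    rw [map_add, mul_add, map_add, hf, hg, mul_add, map_add, map_add]
    ring

theorem tensorFunctional_eq_zero (φ : ∀ c, MvPolynomial (τ c) (F c) →ₗ[F c] F c)
    (hφ : ∀ c, ∀ f ∈ J c, φ c f = 0) {f : MvPolynomial σ L}
    (hf : f ∈ ⨆ c, (J c).map (blockHom E ρ c)) : tensorFunctional E ρ φ f = 0 := by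
  classical
  -- The kernel of a functional is not an ideal, so the induction carries all multiples of `f`.
  suffices h : ∀ g, tensorFunctional E ρ φ (g * f) = 0 by simpa using h 1
  refine Submodule.iSup_induction _ (motive := fun f => ∀ g, tensorFunctional E ρ φ (g * f) = 0)
    hf ?_ ?_ ?_
  · intro c f hf
    refine Submodule.span_induction (p := fun f _ => ∀ g, tensorFunctional E ρ φ (g * f) = 0)
      ?_ ?_ ?_ ?_ hf
    · rintro _ ⟨y, hy, rfl⟩ g
      induction g using MvPolynomial.induction_on' with
      | monomial a r =>
        change tensorFunctional E ρ φ (monomial a r * blockHom E ρ c y) = 0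
        rw [tensorFunctional_monomial_mul_blockHom, hφ c _ ((J c).mul_mem_left _ hy)]
        simp
      | add g h hg hh => rw [add_mul, map_add, hg, hh, add_zero]
    · simp
    · intro x y _ _ hx hy g
      rw [mul_add, map_add, hx, hy, add_zero]
    · intro r x _ hx g
      rw [smul_eq_mul, ← mul_assoc, hx]
  · simp
  · intro x y hx hy g
    rw [mul_add, map_add, hx, hy, add_zero]

/-- A leading exponent of a sum of ideals in disjoint sets of variables restricts to a leading
exponent of one of them. -/
theorem exists_exponentPart_mem_leadingExponents
    (hm : ∀ c a b, a ≼[mb c] b → exponentExtend E c a ≼[m] exponentExtend E c b)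
    (hI : I = ⨆ c, (J c).map (blockHom E ρ c)) {a : σ →₀ ℕ} (ha : a ∈ leadingExponents m I) :
    ∃ c, exponentPart E c a ∈ leadingExponents (mb c) (J c) := by
  classical
  by_contra! hcon
  -- The tensor product of these functionals kills `f`, yet on `f` it sees only the leading term,
  -- with nonzero value: any smaller exponent is smaller in some block and is killed there.
  choose φ hφ₁ hφ₂ hφ₃ using fun c => exists_functional_of_notMem_leadingExponents (mb c) (hcon c)
  obtain ⟨f, hf, hf0, rfl⟩ := ha
  have h0 := tensorFunctional_eq_zero E ρ φ hφ₁ (hI ▸ hf)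
  rw [f.as_sum, map_sum, Finset.sum_eq_single (m.degree f), tensorFunctional_monomial,
    mul_eq_zero, Finset.prod_eq_zero_iff] at h0
  · rcases h0 with h0 | ⟨c, -, h0⟩
    · exact m.coeff_degree_ne_zero_iff.2 hf0 h0
    · exact hφ₃ c ((map_eq_zero _).1 h0)
  · intro b hb hba
    have hlt : b ≺[m] m.degree f :=
      lt_of_le_of_ne (m.le_degree hb) fun h => hba (m.toSyn.injective h)
    obtain ⟨c, hc⟩ : ∃ c, exponentPart E c b ≺[mb c] exponentPart E c (m.degree f) := by
      by_contra! hle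
      refine hlt.not_ge ?_
      rw [← sum_exponentExtend_exponentPart E b,
        ← sum_exponentExtend_exponentPart E (m.degree f), map_sum, map_sum]
      exact Finset.sum_le_sum fun c _ => hm c _ _ (hle c)
    rw [tensorFunctional_monomial,
      Finset.prod_eq_zero (Finset.mem_univ c) (by rw [hφ₂ c _ hc, map_zero]), mul_zero]
  · intro h
    exact absurd (m.degree_mem_support hf0) h

theorem mem_exponentCovers_leadingExponents_iff
    (hm : ∀ c a b, a ≼[mb c] b → exponentExtend E c a ≼[m] exponentExtend E c b)
    (hI : I = ⨆ c, (J c).map (blockHom E ρ c)) (T : Set σ) :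
    T ∈ exponentCovers (leadingExponents m I) ↔
      ∀ c, blockPart E c T ∈ exponentCovers (leadingExponents (mb c) (J c)) := by
  constructor
  · intro hT c a ha
    obtain ⟨k, hk, hk'⟩ := hT _ (exponentExtend_mem_leadingExponents E ρ m mb hm c
      (hI ▸ le_iSup (fun c => (J c).map (blockHom E ρ c)) c) ha)
    obtain ⟨⟨d, j⟩, rfl⟩ := E.surjective k
    by_cases h : d = c
    · subst h
      exact ⟨j, hk, by simpa using hk'⟩
    · exact absurd (exponentExtend_ne E h a j) hk'
  · intro hT a ha
    obtain ⟨c, hc⟩ := exists_exponentPart_mem_leadingExponents E ρ m mb hm hI ha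
    obtain ⟨j, hj, hj'⟩ := hT c _ hc
    exact ⟨_, hj, hj'⟩

end Blocks

/-! ### Connected components, the lexicographic order and generic coordinates. -/

section Graph

variable {K V : Type*} [Field K]

/-- The inclusion of the variables attached to the vertices in `W`. -/
def varsInclusion (W : Set V) (k : Vars W) : Vars V :=
  toLex (Sum.map Subtype.val Subtype.val (ofLex k))

@[simp] theorem varsInclusion_xIdx (W : Set V) (v : W) :
    varsInclusion W (xIdx v) = xIdx (v : V) := rfl

@[simp] theorem varsInclusion_yIdx (W : Set V) (v : W) :
    varsInclusion W (yIdx v) = yIdx (v : V) := rfl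

theorem vars_cases {motive : Vars V → Prop} (hx : ∀ v, motive (xIdx v))
    (hy : ∀ v, motive (yIdx v)) (k : Vars V) : motive k := by
  obtain ⟨k | k, rfl⟩ := toLex.surjective k
  exacts [hx k, hy k]

theorem varsInclusion_strictMono [LinearOrder V] (W : Set V) : StrictMono (varsInclusion W) := by
  intro a b h
  obtain ⟨a, rfl⟩ := toLex.surjective a
  obtain ⟨b, rfl⟩ := toLex.surjective b
  rcases a with a | a <;> rcases b with b | b
  · have h : a < b := Sum.Lex.inl_lt_inl_iff.1 h
    exact Sum.Lex.inl_lt_inl_iff.2 h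
  · exact Sum.Lex.inl_lt_inr _ _
  · exact absurd h Sum.Lex.not_inr_lt_inl
  · have h : a < b := Sum.Lex.inr_lt_inr_iff.1 h
    exact Sum.Lex.inr_lt_inr_iff.2 h

/-- The inclusion of variables preserves order and both extended exponents vanish off its range, so
the first difference stays first. -/
theorem mapDomain_lexOrder_le [LinearOrder V] [Finite V] (W : Set V) {a b : Vars W →₀ ℕ}
    (h : a ≼[lexOrder W] b) :
    a.mapDomain (varsInclusion W) ≼[lexOrder V] b.mapDomain (varsInclusion W) := by
  have hinj := (varsInclusion_strictMono W).injective
  rcases h.eq_or_lt with h | h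
  · rw [(lexOrder W).toSyn.injective h]
  · refine le_of_lt ?_
    change toLex a < toLex b at h
    change toLex (a.mapDomain (varsInclusion W)) < toLex (b.mapDomain (varsInclusion W))
    rw [Finsupp.Lex.lt_iff] at h ⊢
    obtain ⟨i, hi, hlt⟩ := h
    refine ⟨varsInclusion W i, fun k hk => ?_, ?_⟩
    · change a.mapDomain (varsInclusion W) k = b.mapDomain (varsInclusion W) k
      by_cases h : k ∈ Set.range (varsInclusion W)
      · obtain ⟨j, rfl⟩ := h
        rw [Finsupp.mapDomain_apply hinj, Finsupp.mapDomain_apply hinj]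
        exact hi j ((varsInclusion_strictMono W).lt_iff_lt.1 hk)
      · rw [Finsupp.mapDomain_of_notMem_range _ _ h, Finsupp.mapDomain_of_notMem_range _ _ h]
    · change a.mapDomain (varsInclusion W) _ < b.mapDomain (varsInclusion W) _
      rw [Finsupp.mapDomain_apply hinj, Finsupp.mapDomain_apply hinj]
      exact hlt

variable (G : SimpleGraph V)

/-- The variables of all connected components together are the variables of the graph. -/
noncomputable def componentVarsEquiv : (Σ c : G.ConnectedComponent, Vars c.supp) ≃ Vars V :=
  Equiv.ofBijective (fun k => varsInclusion k.1.supp k.2) <| by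
    constructor
    · rintro ⟨c, k⟩ ⟨d, l⟩ h
      obtain ⟨k, rfl⟩ := toLex.surjective k
      obtain ⟨l, rfl⟩ := toLex.surjective l
      rcases k with ⟨k, hk⟩ | ⟨k, hk⟩ <;> rcases l with ⟨l, hl⟩ | ⟨l, hl⟩ <;>
        simp only [varsInclusion, ofLex_toLex, Sum.map_inl, Sum.map_inr, toLex_inj, Sum.inl.injEq,
          Sum.inr.injEq, reduceCtorEq] at h
      all_goals
        subst h
        obtain rfl := hk
        obtain rfl := hl
        rfl
    · intro k
      induction k using vars_cases with
      | hx v => exact ⟨⟨G.connectedComponentMk v, xIdx ⟨v, rfl⟩⟩, rfl⟩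
      | hy v => exact ⟨⟨G.connectedComponentMk v, yIdx ⟨v, rfl⟩⟩, rfl⟩

theorem componentVarsEquiv_apply (c : G.ConnectedComponent) (k : Vars c.supp) :
    componentVarsEquiv G ⟨c, k⟩ = varsInclusion c.supp k := rfl

theorem canonicalInclusion_eq_blockExtend (c : G.ConnectedComponent) :
    canonicalInclusion c.supp = blockExtend (componentVarsEquiv G) c := by
  funext p
  refine block_funext (componentVarsEquiv G) fun d k => ?_
  by_cases h : d = c
  · subst h
    rw [blockExtend_same, componentVarsEquiv_apply]
    induction k using vars_cases with
    | hx v => exact dif_pos v.2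
    | hy v => exact dif_pos v.2
  · rw [blockExtend_ne _ h, componentVarsEquiv_apply]
    have hd : ∀ v : d.supp, (v : V) ∉ c.supp := fun v hv => h (v.2.symm.trans hv)
    induction k using vars_cases with
    | hx v => exact dif_neg (hd v)
    | hy v => exact dif_neg (hd v)

/-- Vanishing constant terms ensure that `0` is not a leading exponent. -/
theorem binomialEdgeIdeal_le_ker :
    binomialEdgeIdeal K G ≤ RingHom.ker (constantCoeff : MvPolynomial (Vars V) K →+* K) := by
  rw [binomialEdgeIdeal, Ideal.span_le]
  rintro _ ⟨i, j, -, rfl⟩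
  simp

theorem constantCoeff_genericChange (f : MvPolynomial (Vars V) K) :
    constantCoeff (genericChange K V f) = algebraMap K (GenericField K V) (constantCoeff f) := by
  have h : (constantCoeff : MvPolynomial (Vars V) (GenericField K V) →+* _).comp
      (genericChange K V : MvPolynomial (Vars V) K →+* _) =
      (algebraMap K (GenericField K V)).comp constantCoeff := by
    refine ringHom_ext (fun r => ?_) fun k => ?_
    · simp [MvPolynomial.algebraMap_eq, IsScalarTower.algebraMap_apply K (GenericField K V)
        (MvPolynomial (Vars V) (GenericField K V))]
    · induction k using vars_cases with
      | hx v => simp [genericChange, xIdx]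
      | hy v => simp [genericChange, yIdx]
  exact RingHom.congr_fun h f

theorem map_genericChange_le_ker {I : Ideal (MvPolynomial (Vars V) K)}
    (hI : I ≤ RingHom.ker constantCoeff) :
    I.map (genericChange K V) ≤ RingHom.ker constantCoeff := by
  rw [Ideal.map_le_iff_le_comap]
  intro f hf
  have h := constantCoeff_genericChange f
  rw [(hI hf : constantCoeff f = 0), map_zero] at h
  exact h

/-- The binomial edge ideal is the sum of the extensions of those of the components. -/
theorem binomialEdgeIdeal_eq_iSup : binomialEdgeIdeal K G =
    ⨆ c : G.ConnectedComponent, (binomialEdgeIdeal K (G.induce c.supp)).map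
      (rename (varsInclusion c.supp) : MvPolynomial (Vars c.supp) K →ₐ[K] _).toRingHom := by
  apply le_antisymm
  · conv_lhs => rw [binomialEdgeIdeal]
    rw [Ideal.span_le]
    rintro _ ⟨i, j, hij, rfl⟩
    let c := G.connectedComponentMk i
    have hj : j ∈ c.supp := (SimpleGraph.ConnectedComponent.sound hij.reachable).symm
    refine Ideal.mem_iSup_of_mem c ?_
    have hmem : X (xIdx ⟨i, rfl⟩) * X (yIdx ⟨j, hj⟩) - X (xIdx ⟨j, hj⟩) * X (yIdx ⟨i, rfl⟩) ∈
        binomialEdgeIdeal K (G.induce c.supp) :=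
      Ideal.subset_span ⟨⟨i, rfl⟩, ⟨j, hj⟩, hij, rfl⟩
    have h := Ideal.mem_map_of_mem
      (rename (varsInclusion c.supp) : MvPolynomial (Vars c.supp) K →ₐ[K] _).toRingHom hmem
    simpa only [AlgHom.toRingHom_eq_coe, RingHom.coe_coe, map_sub, map_mul, rename_X,
      varsInclusion_xIdx, varsInclusion_yIdx] using h
  · refine iSup_le fun c => ?_
    rw [Ideal.map_le_iff_le_comap, binomialEdgeIdeal, Ideal.span_le]
    rintro _ ⟨i, j, hij, rfl⟩
    refine Ideal.subset_span ⟨i, j, hij, ?_⟩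
    simp

/-- The inclusion of the fields of generic matrix entries. -/
noncomputable def genericFieldHom (K : Type*) [Field K] (W : Set V) :
    GenericField K W →+* GenericField K V :=
  IsFractionRing.map (A := MvPolynomial (W × Fin 2 × Fin 2) K)
    (B := MvPolynomial (V × Fin 2 × Fin 2) K)
    (j := (rename (Prod.map Subtype.val id) : _ →ₐ[K] _).toRingHom)
    (rename_injective _ (Subtype.val_injective.prodMap Function.injective_id))

theorem genericFieldHom_algebraMap (W : Set V) (f : MvPolynomial (W × Fin 2 × Fin 2) K) :
    genericFieldHom K W (algebraMap _ (GenericField K W) f) =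
      algebraMap _ (GenericField K V) (rename (Prod.map Subtype.val id) f) := by
  unfold genericFieldHom IsFractionRing.map
  exact IsLocalization.map_eq _ _

theorem genericFieldHom_genericEntry (W : Set V) (v : W) (a b : Fin 2) :
    genericFieldHom K W (genericEntry K v a b) = genericEntry K (v : V) a b := by
  rw [genericEntry, genericFieldHom_algebraMap, rename_X]
  rfl

/-- The generic matrix at a vertex is the same whether formed in its component or in the whole
graph, so changing coordinates commutes with including the component. -/
theorem blockHom_comp_genericChange (c : G.ConnectedComponent) :
    (blockHom (componentVarsEquiv G)
        (fun c : G.ConnectedComponent => genericFieldHom K c.supp) c).comp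
        (genericChange K c.supp : MvPolynomial (Vars c.supp) K →+* _) =
      (genericChange K V : MvPolynomial (Vars V) K →+* _).comp
        (rename (varsInclusion c.supp) : MvPolynomial (Vars c.supp) K →ₐ[K] _).toRingHom := by
  refine ringHom_ext (fun r => ?_) fun k => ?_
  · have h : genericFieldHom K c.supp (algebraMap K (GenericField K c.supp) r) =
        algebraMap K (GenericField K V) r := by
      rw [IsScalarTower.algebraMap_apply K (MvPolynomial (c.supp × Fin 2 × Fin 2) K),
        genericFieldHom_algebraMap, IsScalarTower.algebraMap_apply K
        (MvPolynomial (V × Fin 2 × Fin 2) K) (GenericField K V)]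
      simp [MvPolynomial.algebraMap_eq]
    have e1 : genericChange K c.supp (C r) = C (algebraMap K _ r) :=
      (genericChange K c.supp).commutes r
    have e2 : genericChange K V (C r) = C (algebraMap K _ r) := (genericChange K V).commutes r
    simp [e1, e2, blockHom, h]
  · induction k using vars_cases with
    | hx v => simp [blockHom, genericChange, xIdx, yIdx, componentVarsEquiv_apply, varsInclusion,
        genericFieldHom_genericEntry]
    | hy v => simp [blockHom, genericChange, xIdx, yIdx, componentVarsEquiv_apply, varsInclusion,
        genericFieldHom_genericEntry]

theorem map_genericChange_binomialEdgeIdeal :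
    (binomialEdgeIdeal K G).map (genericChange K V) =
      ⨆ c : G.ConnectedComponent,
        ((binomialEdgeIdeal K (G.induce c.supp)).map (genericChange K c.supp)).map
          (blockHom (componentVarsEquiv G)
            (fun c : G.ConnectedComponent => genericFieldHom K c.supp) c) := by
  conv_lhs => rw [binomialEdgeIdeal_eq_iSup, Ideal.map_iSup]
  refine iSup_congr fun c => ?_
  rw [← Ideal.map_coe (genericChange K V), ← Ideal.map_coe (genericChange K c.supp),
    Ideal.map_map, Ideal.map_map, blockHom_comp_genericChange]

theorem binomialEdgeIdeal_eq_iSup_blockHom : binomialEdgeIdeal K G =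
    ⨆ c : G.ConnectedComponent, (binomialEdgeIdeal K (G.induce c.supp)).map
      (blockHom (componentVarsEquiv G) (fun _ => RingHom.id K) c) := by
  conv_lhs => rw [binomialEdgeIdeal_eq_iSup]
  refine iSup_congr fun c => ?_
  congr 1
  refine RingHom.ext fun f => ?_
  rw [blockHom, RingHom.comp_apply, MvPolynomial.map_id]
  rfl

variable [LinearOrder V] [Finite V]

theorem leadingMonomialIdeal_eq_monomialSpan {L : Type*} [Field L]
    (I : Ideal (MvPolynomial (Vars V) L)) :
    leadingMonomialIdeal K I = monomialSpan K (leadingExponents (lexOrder V) I) := by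
  rw [leadingMonomialIdeal, monomialSpan]
  congr 1
  ext p
  constructor
  · rintro ⟨f, hf, hf0, rfl⟩
    exact ⟨_, ⟨f, hf, hf0, rfl⟩, rfl⟩
  · rintro ⟨_, ⟨f, hf, hf0, rfl⟩, rfl⟩
    exact ⟨f, hf, hf0, rfl⟩

/-- Vertices of symbolic polyhedra of leading monomial ideals, for sums of ideals living on the
connected components. -/
theorem spVertices_leadingMonomialIdeal {L : Type*} [Field L] {F : G.ConnectedComponent → Type*}
    [∀ c, Field (F c)] (ρ : ∀ c, F c →+* L) {I : Ideal (MvPolynomial (Vars V) L)}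
    {J : ∀ c : G.ConnectedComponent, Ideal (MvPolynomial (Vars c.supp) (F c))}
    (hI : I = ⨆ c, (J c).map (blockHom (componentVarsEquiv G) ρ c))
    (hJ : ∀ c, J c ≤ RingHom.ker constantCoeff) :
    spVertices (leadingMonomialIdeal K I) =
        ⋃ c : G.ConnectedComponent, canonicalInclusion c.supp ''
          spVertices (leadingMonomialIdeal K (J c)) ∧
      Pairwise fun c d : G.ConnectedComponent => Disjoint
        (canonicalInclusion c.supp '' spVertices (leadingMonomialIdeal K (J c)))
        (canonicalInclusion d.supp '' spVertices (leadingMonomialIdeal K (J d))) := by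
  have := Fintype.ofFinite G.ConnectedComponent
  simp only [canonicalInclusion_eq_blockExtend, leadingMonomialIdeal_eq_monomialSpan]
  exact spVertices_monomialSpan_blocks (componentVarsEquiv G)
    (fun c => zero_notMem_leadingExponents _ (hJ c))
    (mem_exponentCovers_leadingExponents_iff (componentVarsEquiv G) ρ (lexOrder V)
      (fun c => lexOrder c.supp) (fun c _ _ h => mapDomain_lexOrder_le c.supp h) hI)

end Graph

theorem mainTheorem7 {K : Type*} [Field K] (n : ℕ) (G : SimpleGraph (Fin n)) :
    (spVertices (multigradedGin (binomialEdgeIdeal K G)) =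
        ⋃ c : G.ConnectedComponent, canonicalInclusion c.supp ''
          spVertices (multigradedGin (binomialEdgeIdeal K (G.induce c.supp))) ∧
      Pairwise fun c d : G.ConnectedComponent => Disjoint
        (canonicalInclusion c.supp ''
          spVertices (multigradedGin (binomialEdgeIdeal K (G.induce c.supp))))
        (canonicalInclusion d.supp ''
          spVertices (multigradedGin (binomialEdgeIdeal K (G.induce d.supp))))) ∧
    (spVertices (initialIdeal (binomialEdgeIdeal K G)) =
        ⋃ c : G.ConnectedComponent, canonicalInclusion c.supp ''
          spVertices (initialIdeal (binomialEdgeIdeal K (G.induce c.supp))) ∧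
      Pairwise fun c d : G.ConnectedComponent => Disjoint
        (canonicalInclusion c.supp ''
          spVertices (initialIdeal (binomialEdgeIdeal K (G.induce c.supp))))
        (canonicalInclusion d.supp ''
          spVertices (initialIdeal (binomialEdgeIdeal K (G.induce d.supp))))) :=
  ⟨spVertices_leadingMonomialIdeal G (fun c => genericFieldHom K c.supp)
      (map_genericChange_binomialEdgeIdeal G)
      fun _ => map_genericChange_le_ker (binomialEdgeIdeal_le_ker _),
    spVertices_leadingMonomialIdeal G (fun _ => RingHom.id K)
      (binomialEdgeIdeal_eq_iSup_blockHom G) fun _ => binomialEdgeIdeal_le_ker _⟩
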